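/- Let $\ell, m \ge 2$ be integers and set $n = \ell m$. Let $k$ be an algebraically closed field whose characteristic does not divide $\ell$. For a group $G$ and an $n$-dimensional $k$-vector space $V$, a representation $\rho : G \to \mathrm{GL}(V)$ is called $d$-thick if for all subspaces $V_1, V_2$ of $V$ with $\dim V_1 = d$ and $\dim V_2 = n - d$ there exists $g \in G$ such that $(\rho(g) V_1) \oplus V_2 = V$. For $m \times m$ matrices $M_1, \dots, M_\ell$ over $k$, let $\Phi(M_1, \dots, M_\ell)$ be the $n \times n$ matrix, divided into $\ell \times \ell$ blocks of size $m \times m$, whose block in position $(j+1, j)$ is $M_j$ for $1 \le j \le \ell - 1$, whose block in position $(1, \ell)$ is $M_\ell$, and whose other blocks are $0$. Then there exists an irreducible representation $\rho : \mathrm{F}_2 \to \mathrm{GL}_n(k)$ of the free group $\mathrm{F}_2 = \langle \alpha, \beta \rangle$ of rank $2$ such that $\rho$ is neither $m$-thick nor $\ell$-thick. Moreover, $\rho$ can be chosen such that $$\rho(\alpha) = \Phi(I_m, \dots, I_m, \mathrm{diag}(\alpha_1, \dots, \alpha_m)), \qquad \rho(\beta) = \Phi(B_1, \dots, B_\ell)$$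 for some pairwise distinct $\alpha_1, \dots, \alpha_m \in k^{\times}$ and some $B_1, \dots, B_\ell \in \mathrm{GL}_m(k)$. -/

import Mathlib

/-- A representation `ρ` of a group `G` on a finite-dimensional vector space `V` is `m`-thick if
for all subspaces `V₁`, `V₂` of `V` with `dim V₁ = m` and `dim V₂ = dim V - m` there is `g : G`
such that `V` is the internal direct sum of `ρ(g) V₁` and `V₂`. -/
def IsThick {k G V : Type*} [Field k] [Group G] [AddCommGroup V] [Module k V]
    [FiniteDimensional k V] (ρ : Representation k G V) (m : ℕ) : Prop :=
  ∀ V₁ V₂ : Submodule k V, Module.finrank k V₁ = m →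
    m + Module.finrank k V₂ = Module.finrank k V →
    ∃ g : G, IsCompl (V₁.map (ρ g)) V₂

/-- The representation on column vectors given by a homomorphism to `GL n k`:
`g` acts by `v ↦ ρ(g) v`. -/
def matrixRep {k G : Type*} [Field k] [Group G] {n : ℕ}
    (ρ : G →* Matrix.GeneralLinearGroup (Fin n) k) : Representation k G (Fin n → k) :=
  ((Matrix.toLinAlgEquiv' : Matrix (Fin n) (Fin n) k ≃ₐ[k] _) : _ →* _).comp
    ((Units.coeHom (Matrix (Fin n) (Fin n) k)).comp ρ)

/-- The block-cyclic `(ℓ m) × (ℓ m)` matrix with `m × m` blocks `M₁, …, M_ℓ`: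
`M₁, …, M_{ℓ-1}` stand on the block subdiagonal (`M_j` in block row `j + 1` and block column `j`),
`M_ℓ` stands in the upper right corner, and all other blocks vanish. Here blocks are numbered from
zero, and `finProdFinEquiv` sends `(i, a)` to the index `m * i + a`. -/
def blockCyclic {k : Type*} [Field k] {ℓ m : ℕ} (M : Fin ℓ → Matrix (Fin m) (Fin m) k) :
    Matrix (Fin (ℓ * m)) (Fin (ℓ * m)) k :=
  Matrix.reindex finProdFinEquiv finProdFinEquiv
    (Matrix.of fun p q : Fin ℓ × Fin m =>
      if (p.1 : ℕ) = ((q.1 : ℕ) + 1) % ℓ then M q.1 p.2 q.2 else 0)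

/-! A block-cyclic matrix with invertible blocks shifts the `ℓ` coordinate blocks by one, so every
group element shifts them by some `r`. A block thus only moves to blocks, each of which meets a
transversal (one position taken in every block). As `ℓ + m ≤ ℓ * m`, a transversal fits in a space
of dimension `n - m` and a block in one of dimension `n - ℓ`; this defeats `m`- and `ℓ`-thickness
(`not_isThick_block`, `not_isThick_transversal`).

For irreducibility, let `A` and `B` be the images of the generators. `A ^ ℓ` is diagonal with
eigenvalue `α a` at position `a` of every block, so an invariant subspace is stable under projection
to each position. Only block `0` of `B` is non-diagonal, with nonzero off-diagonal entries; `B`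
followed by a projection then isolates one basis vector, and powers of `A` and further uses of `B`
give all of them (`eq_bot_or_eq_top_of_stable_blockCyclic`). -/

/-! ### Block-cyclic matrices acting on vectors -/

open Matrix in
theorem blockCyclic_mulVec_apply {k : Type*} [Field k] {ℓ m : ℕ} [NeZero ℓ]
    (M : Fin ℓ → Matrix (Fin m) (Fin m) k) (u : Fin (ℓ * m) → k) (q : Fin ℓ) (a : Fin m) :
    (blockCyclic M *ᵥ u) (finProdFinEquiv (q + 1, a)) =
      (M q *ᵥ fun b => u (finProdFinEquiv (q, b))) a := by
  have key (p : Fin ℓ) : (((q + 1 : Fin ℓ) : ℕ) = ((p : ℕ) + 1) % ℓ) ↔ q = p := by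
    have h : ((p : ℕ) + 1) % ℓ = ((p + 1 : Fin ℓ) : ℕ) := by
      simp [Fin.val_add, Nat.add_mod]
    rw [h, Fin.val_inj, add_left_inj]
  rw [blockCyclic, Matrix.reindex_apply, Matrix.submatrix_mulVec_equiv]
  simp only [Matrix.mulVec, dotProduct, Function.comp_apply, Equiv.symm_symm,
    Equiv.symm_apply_apply, Fintype.sum_prod_type, Matrix.of_apply, key]
  rw [Finset.sum_eq_single q]
  · simp
  · intro p _ hp
    simp [Ne.symm hp]
  · simp

/-- Coordinates are written with block `q + r` because the action formulas describe the image at a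
shifted block. -/
theorem finProdFinEquiv_add_ind {ℓ m : ℕ} [NeZero ℓ] {P : Fin (ℓ * m) → Prop} (r : Fin ℓ)
    (h : ∀ q a, P (finProdFinEquiv (q + r, a))) (x : Fin (ℓ * m)) : P x := by
  obtain ⟨⟨q, a⟩, rfl⟩ := finProdFinEquiv.surjective x
  simpa using h (q - r) a

open Matrix in
theorem isUnit_blockCyclic {k : Type*} [Field k] {ℓ m : ℕ} [NeZero ℓ]
    (M : Fin ℓ → Matrix (Fin m) (Fin m) k) (hM : ∀ j, IsUnit (M j)) :
    IsUnit (blockCyclic M) := by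
  rw [← Matrix.mulVec_injective_iff_isUnit]
  intro u v huv
  refine funext (finProdFinEquiv_add_ind 0 fun q a => ?_)
  have h : (M q *ᵥ fun b => u (finProdFinEquiv (q, b))) =
      (M q *ᵥ fun b => v (finProdFinEquiv (q, b))) := by
    ext b
    rw [← blockCyclic_mulVec_apply, ← blockCyclic_mulVec_apply, huv]
  simpa using congrFun (Matrix.mulVec_injective_iff_isUnit.mpr (hM q) h) a

/-! ### Coordinate subspaces, blocks and transversals -/

/-- The vectors supported on a set of coordinates. -/
def coordinateSubmodule (k : Type*) [Field k] {ι : Type*} (S : Set ι) : Submodule k (ι → k) where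
  carrier := {u | ∀ i ∉ S, u i = 0}
  add_mem' hu hv i hi := by simp [hu i hi, hv i hi]
  zero_mem' := by simp
  smul_mem' c u hu i hi := by simp [hu i hi]

theorem mem_coordinateSubmodule {k : Type*} [Field k] {ι : Type*} {S : Set ι} {u : ι → k} :
    u ∈ coordinateSubmodule k S ↔ ∀ i ∉ S, u i = 0 := Iff.rfl

theorem coordinateSubmodule_mono {k : Type*} [Field k] {ι : Type*} {S T : Set ι} (h : S ⊆ T) :
    coordinateSubmodule k S ≤ coordinateSubmodule k T :=
  fun _ hu i hi => hu i fun hS => hi (h hS)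

theorem single_mem_coordinateSubmodule {k : Type*} [Field k] {ι : Type*} [DecidableEq ι]
    {S : Set ι} {i : ι} (hi : i ∈ S) : Pi.single i (1 : k) ∈ coordinateSubmodule k S := by
  intro j hj
  rw [Pi.single_apply, if_neg]
  rintro rfl
  exact hj hi

theorem finrank_coordinateSubmodule {k : Type*} [Field k] {ι : Type*} (S : Finset ι) :
    Module.finrank k (coordinateSubmodule k (S : Set ι)) = S.card := by
  classical
  let f : coordinateSubmodule k (S : Set ι) ≃ₗ[k] (S → k) :=
    { toFun := fun u i => u.1 i
      invFun := fun v => ⟨fun i => if h : i ∈ S then v ⟨i, h⟩ else 0, fun i hi => by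
        exact dif_neg (by simpa using hi)⟩
      map_add' := fun _ _ => rfl
      map_smul' := fun _ _ => rfl
      left_inv := fun u => by
        ext i
        by_cases h : i ∈ S
        · simp [h]
        · simp [h, u.2 i (by simpa using h)]
      right_inv := fun v => by ext i; simp }
  rw [f.finrank_eq, Module.finrank_fintype_fun_eq_card, Fintype.card_coe]

/-- The indices of the `q`-th block. -/
def blockIndices {ℓ m : ℕ} (q : Fin ℓ) : Finset (Fin (ℓ * m)) :=
  Finset.univ.map ⟨fun a : Fin m => finProdFinEquiv (q, a), fun _ _ h => by simpa using h⟩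

theorem mem_blockIndices {ℓ m : ℕ} {p q : Fin ℓ} {a : Fin m} :
    finProdFinEquiv (p, a) ∈ blockIndices (m := m) q ↔ p = q := by
  rw [blockIndices, Finset.mem_map]
  constructor
  · rintro ⟨b, -, h⟩
    exact (congrArg Prod.fst (finProdFinEquiv.injective h)).symm
  · rintro rfl
    exact ⟨a, Finset.mem_univ a, rfl⟩

theorem card_blockIndices {ℓ m : ℕ} (q : Fin ℓ) : (blockIndices (m := m) q).card = m := by
  simp [blockIndices]

/-- The indices at position `a` in some block. -/
def transversalIndices {ℓ m : ℕ} (a : Fin m) : Finset (Fin (ℓ * m)) :=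
  Finset.univ.map ⟨fun q : Fin ℓ => finProdFinEquiv (q, a), fun _ _ h => by simpa using h⟩

theorem mem_transversalIndices {ℓ m : ℕ} (q : Fin ℓ) (a : Fin m) :
    finProdFinEquiv (q, a) ∈ transversalIndices (ℓ := ℓ) a :=
  Finset.mem_map.mpr ⟨q, Finset.mem_univ q, rfl⟩

theorem card_transversalIndices {ℓ m : ℕ} (a : Fin m) :
    (transversalIndices (ℓ := ℓ) a).card = ℓ := by
  simp [transversalIndices]

/-- The coordinate subspace of the `q`-th block. -/
abbrev blockSubmodule (k : Type*) [Field k] {ℓ m : ℕ} (q : Fin ℓ) :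
    Submodule k (Fin (ℓ * m) → k) :=
  coordinateSubmodule k ((blockIndices q : Finset (Fin (ℓ * m))) : Set (Fin (ℓ * m)))

/-! ### Cyclic permutation of the blocks -/

theorem matrixRep_apply {k G : Type*} [Field k] [Group G] {n : ℕ}
    (ρ : G →* Matrix.GeneralLinearGroup (Fin n) k) (g : G) (v : Fin n → k) :
    matrixRep ρ g v = Matrix.mulVec (ρ g : Matrix (Fin n) (Fin n) k) v := rfl

open Matrix in
theorem map_blockSubmodule_of_eq_blockCyclic {k G : Type*} [Field k] [Group G] {ℓ m : ℕ}
    [NeZero ℓ] (ρ : G →* Matrix.GeneralLinearGroup (Fin (ℓ * m)) k) (g : G)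
    (M : Fin ℓ → Matrix (Fin m) (Fin m) k) (hM : ∀ j, IsUnit (M j))
    (hg : (ρ g : Matrix (Fin (ℓ * m)) (Fin (ℓ * m)) k) = blockCyclic M) (q : Fin ℓ) :
    (blockSubmodule k q).map (matrixRep ρ g) = blockSubmodule k (q + 1) := by
  apply le_antisymm
  · rintro _ ⟨u, hu, rfl⟩
    rw [mem_coordinateSubmodule]
    refine finProdFinEquiv_add_ind 1 fun p a hp => ?_
    simp only [Finset.mem_coe, mem_blockIndices, add_left_inj] at hp
    rw [matrixRep_apply, hg, blockCyclic_mulVec_apply]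
    have : (fun b => u (finProdFinEquiv (p, b))) = 0 := by
      ext b
      exact hu _ (by simpa [mem_blockIndices] using hp)
    rw [this, Matrix.mulVec_zero, Pi.zero_apply]
  · intro v hv
    obtain ⟨u, rfl⟩ := Matrix.mulVec_surjective_iff_isUnit.mpr (isUnit_blockCyclic M hM) v
    refine ⟨u, ?_, by rw [matrixRep_apply, hg]⟩
    rw [SetLike.mem_coe, mem_coordinateSubmodule]
    refine finProdFinEquiv_add_ind 0 fun p a hp => ?_
    simp only [Finset.mem_coe, mem_blockIndices, add_zero] at hp
    have h : (M p *ᵥ fun b => u (finProdFinEquiv (p, b))) = M p *ᵥ 0 := by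
      ext b
      rw [← blockCyclic_mulVec_apply, Matrix.mulVec_zero]
      exact hv _ (by simpa [mem_blockIndices] using hp)
    simpa using congrFun (Matrix.mulVec_injective_iff_isUnit.mpr (hM p) h) a

/-- A representation permutes the blocks cyclically if all generators do. -/
theorem exists_map_blockSubmodule {k ι : Type*} [Field k] {ℓ m : ℕ} [NeZero ℓ]
    (ρ : Representation k (FreeGroup ι) (Fin (ℓ * m) → k))
    (h : ∀ i q, (blockSubmodule k q).map (ρ (FreeGroup.of i)) = blockSubmodule k (q + 1))
    (g : FreeGroup ι) :
    ∃ r : Fin ℓ, ∀ q, (blockSubmodule k q).map (ρ g) = blockSubmodule k (q + r) := by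
  induction g using FreeGroup.induction_on with
  | C1 => exact ⟨0, fun q => by rw [map_one, Module.End.one_eq_id, Submodule.map_id, add_zero]⟩
  | of i => exact ⟨1, h i⟩
  | inv_of i _ =>
    refine ⟨-1, fun q => ?_⟩
    have := h i (q + -1)
    rw [neg_add_cancel_right] at this
    rw [← this, ← Submodule.map_comp, ← Module.End.mul_eq_comp, ← map_mul, inv_mul_cancel,
      map_one, Module.End.one_eq_id, Submodule.map_id]
  | mul x y hx hy =>
    obtain ⟨r, hr⟩ := hx
    obtain ⟨s, hs⟩ := hy
    refine ⟨s + r, fun q => ?_⟩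
    rw [map_mul, Module.End.mul_eq_comp, Submodule.map_comp, hs, hr, add_assoc]

/-! ### Failure of thickness -/

theorem exists_coordinateSubmodule_ge {k : Type*} [Field k] {n d : ℕ} (S : Finset (Fin n))
    (hd : S.card + d ≤ n) :
    ∃ V : Submodule k (Fin n → k), coordinateSubmodule k (S : Set (Fin n)) ≤ V ∧
      d + Module.finrank k V = Module.finrank k (Fin n → k) := by
  obtain ⟨T, hST, -, hT⟩ := Finset.exists_subsuperset_card_eq (n := n - d) S.subset_univ
    (by omega) (by simp)
  refine ⟨coordinateSubmodule k (T : Set (Fin n)), coordinateSubmodule_mono (by simpa using hST),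
    ?_⟩
  rw [finrank_coordinateSubmodule, hT, Module.finrank_fin_fun]
  omega

theorem single_ne_zero_of_field {k ι : Type*} [Field k] [DecidableEq ι] (i : ι) :
    (Pi.single i (1 : k) : ι → k) ≠ 0 := by
  simp

/-- `V₁` is block `0` and `V₂` contains a transversal. Any image of `V₁` is a block, which shares a
basis vector with the transversal. -/
theorem not_isThick_block {k G : Type*} [Field k] [Group G] {ℓ m : ℕ} [NeZero ℓ] [NeZero m]
    (ρ : Representation k G (Fin (ℓ * m) → k))
    (h : ∀ g, ∃ r : Fin ℓ, ∀ q, (blockSubmodule k q).map (ρ g) = blockSubmodule k (q + r))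
    (hd : ℓ + m ≤ ℓ * m) : ¬ IsThick ρ m := by
  intro hT
  obtain ⟨V, hV, hfin⟩ := exists_coordinateSubmodule_ge (k := k) (d := m)
    (transversalIndices (ℓ := ℓ) (0 : Fin m)) (by rwa [card_transversalIndices])
  obtain ⟨g, hg⟩ := hT (blockSubmodule k 0) V
    (by rw [finrank_coordinateSubmodule, card_blockIndices]) hfin
  obtain ⟨r, hr⟩ := h g
  rw [hr] at hg
  exact single_ne_zero_of_field _ (Submodule.disjoint_def.mp hg.disjoint
    (Pi.single (finProdFinEquiv (r, 0)) 1)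
    (single_mem_coordinateSubmodule (by simp [mem_blockIndices]))
    (hV (single_mem_coordinateSubmodule (by simp [mem_transversalIndices]))))

/-- The roles are exchanged: `V₁` is a transversal and `V₂` contains block `0`. -/
theorem not_isThick_transversal {k G : Type*} [Field k] [Group G] {ℓ m : ℕ} [NeZero ℓ] [NeZero m]
    (ρ : Representation k G (Fin (ℓ * m) → k))
    (h : ∀ g, ∃ r : Fin ℓ, ∀ q, (blockSubmodule k q).map (ρ g) = blockSubmodule k (q + r))
    (hd : m + ℓ ≤ ℓ * m) : ¬ IsThick ρ ℓ := by
  intro hT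
  obtain ⟨V, hV, hfin⟩ := exists_coordinateSubmodule_ge (k := k) (d := ℓ)
    (blockIndices (m := m) (0 : Fin ℓ)) (by rwa [card_blockIndices])
  obtain ⟨g, hg⟩ := hT (coordinateSubmodule k (transversalIndices (ℓ := ℓ) (0 : Fin m))) V
    (by rw [finrank_coordinateSubmodule, card_transversalIndices]) hfin
  obtain ⟨r, hr⟩ := h g
  -- If `g` shifts by `r`, the vector of the transversal in block `-r` lands in block `0`.
  have hmem : ρ g (Pi.single (finProdFinEquiv (-r, 0)) 1) ∈ blockSubmodule k (0 : Fin ℓ) := by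
    rw [← neg_add_cancel r, ← hr]
    exact Submodule.mem_map_of_mem (single_mem_coordinateSubmodule (by simp [mem_blockIndices]))
  have hzero := Submodule.disjoint_def.mp hg.disjoint _
    (Submodule.mem_map_of_mem (single_mem_coordinateSubmodule
      (Finset.mem_coe.mpr (mem_transversalIndices _ _)))) (hV hmem)
  refine single_ne_zero_of_field (k := k) (finProdFinEquiv (-r, (0 : Fin m))) ?_
  simpa [← Module.End.mul_apply, ← map_mul] using congrArg (ρ g⁻¹) hzero

/-! ### Powers of the diagonal generator and invariant subspaces -/

theorem Fin.val_nsmul_one {ℓ : ℕ} [NeZero ℓ] (n : ℕ) : ((n • (1 : Fin ℓ) : Fin ℓ) : ℕ) = n % ℓ := by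
  induction n with
  | zero => simp
  | succ n ih => rw [succ_nsmul, Fin.val_add, ih, Fin.val_one', ← Nat.add_mod]

theorem Fin.nsmul_val_one {ℓ : ℕ} [NeZero ℓ] (q : Fin ℓ) : (q : ℕ) • (1 : Fin ℓ) = q :=
  Fin.ext (by rw [Fin.val_nsmul_one, Nat.mod_eq_of_lt q.isLt])

open Matrix in
theorem blockCyclic_diagonal_pow_mulVec_apply {k : Type*} [Field k] {ℓ m : ℕ} [NeZero ℓ]
    (c : Fin ℓ → Fin m → k) (r : ℕ) (u : Fin (ℓ * m) → k) (q : Fin ℓ) (a : Fin m) :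
    ((blockCyclic fun j => Matrix.diagonal (c j)) ^ r *ᵥ u)
        (finProdFinEquiv (q + r • (1 : Fin ℓ), a)) =
      (∏ s ∈ Finset.range r, c (q + s • (1 : Fin ℓ)) a) * u (finProdFinEquiv (q, a)) := by
  induction r with
  | zero => simp
  | succ r ih =>
    rw [pow_succ', ← Matrix.mulVec_mulVec, succ_nsmul, ← add_assoc, blockCyclic_mulVec_apply,
      Matrix.mulVec_diagonal, ih, Finset.prod_range_succ]
    ring

-- After `ℓ` steps an entry is back in its block, having met every factor `c p a` once; the product
-- does not depend on the starting block.
open Matrix in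
theorem blockCyclic_diagonal_pow_length_mulVec_apply {k : Type*} [Field k] {ℓ m : ℕ} [NeZero ℓ]
    (c : Fin ℓ → Fin m → k) (u : Fin (ℓ * m) → k) (q : Fin ℓ) (a : Fin m) :
    ((blockCyclic fun j => Matrix.diagonal (c j)) ^ ℓ *ᵥ u) (finProdFinEquiv (q, a)) =
      (∏ p, c p a) * u (finProdFinEquiv (q, a)) := by
  have h := blockCyclic_diagonal_pow_mulVec_apply c ℓ u q a
  have h0 : ℓ • (1 : Fin ℓ) = 0 := Fin.ext (by simp [Fin.val_nsmul_one])
  rw [h0, add_zero] at h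
  rw [h, ← Fin.prod_univ_eq_prod_range (fun s => c (q + s • (1 : Fin ℓ)) a)]
  simp only [Fin.nsmul_val_one]
  rw [← Equiv.prod_comp (Equiv.addLeft q) (fun p => c p a)]
  rfl

/-- A subspace stable under an operator with distinct eigenvalues `α a` is stable under the
projections to its eigenspaces. -/
theorem projection_mem_of_stable {k ι κ : Type*} [Field k] [Fintype κ] [DecidableEq κ]
    (f : ι → κ) (α : κ → k) (hα : Function.Injective α) (U : Submodule k (ι → k))
    (hU : ∀ u ∈ U, (fun i => α (f i) * u i) ∈ U) {u : ι → k} (hu : u ∈ U) (b : κ) :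
    (fun i => if f i = b then u i else 0) ∈ U := by
  -- Lagrange interpolation: the product of the operators `T - α c` over `c ≠ b`, divided by its
  -- value at `α b`, is the projection.
  have key (s : Finset κ) : (fun i => (∏ c ∈ s, (α (f i) - α c)) * u i) ∈ U := by
    induction s using Finset.induction_on with
    | empty => simpa using hu
    | insert c s hc ih =>
      convert U.sub_mem (hU _ ih) (U.smul_mem (α c) ih) using 1
      ext i
      simp only [Finset.prod_insert hc, Pi.sub_apply, Pi.smul_apply, smul_eq_mul]
      ring
  have hne : ∏ c ∈ Finset.univ.erase b, (α b - α c) ≠ 0 :=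
    Finset.prod_ne_zero_iff.mpr fun c hc =>
      sub_ne_zero.mpr fun h => (Finset.ne_of_mem_erase hc) (hα h).symm
  convert U.smul_mem (∏ c ∈ Finset.univ.erase b, (α b - α c))⁻¹ (key (Finset.univ.erase b)) using 1
  ext i
  rw [Pi.smul_apply, smul_eq_mul]
  split_ifs with h
  · rw [h, inv_mul_cancel_left₀ hne]
  · have hzero : ∏ c ∈ Finset.univ.erase b, (α (f i) - α c) = 0 :=
      Finset.prod_eq_zero (Finset.mem_erase.mpr ⟨h, Finset.mem_univ (f i)⟩) (sub_self _)
    rw [hzero, zero_mul, mul_zero]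

open Matrix in
theorem eq_bot_or_eq_top_of_stable_blockCyclic {k : Type*} [Field k] {ℓ m : ℕ} [NeZero ℓ]
    (hm : 2 ≤ m) (c : Fin ℓ → Fin m → k) (hc : ∀ q a, c q a ≠ 0)
    (hinj : Function.Injective fun a => ∏ q, c q a)
    (B : Fin ℓ → Matrix (Fin m) (Fin m) k) (hB0 : ∀ a b, a ≠ b → B 0 a b ≠ 0)
    (hB : ∀ q, q ≠ 0 → ∀ a b, a ≠ b → B q a b = 0)
    (U : Submodule k (Fin (ℓ * m) → k))
    (hUA : ∀ u ∈ U, (blockCyclic fun j => Matrix.diagonal (c j)) *ᵥ u ∈ U)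
    (hUB : ∀ u ∈ U, blockCyclic B *ᵥ u ∈ U) : U = ⊥ ∨ U = ⊤ := by
  have hpow (r : ℕ) : ∀ u ∈ U, (blockCyclic fun j => Matrix.diagonal (c j)) ^ r *ᵥ u ∈ U := by
    induction r with
    | zero => simp
    | succ r ih =>
      intro u hu
      rw [pow_succ', ← Matrix.mulVec_mulVec]
      exact hUA _ (ih u hu)
  have hcol {u} (hu : u ∈ U) (b : Fin m) :
      (fun i => if (finProdFinEquiv.symm i).2 = b then u i else 0) ∈ U := by
    refine projection_mem_of_stable (fun i => (finProdFinEquiv.symm i).2) _ hinj U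
      (fun v hv => ?_) hu b
    convert hpow ℓ v hv using 1
    refine funext (finProdFinEquiv_add_ind 0 fun q a => ?_)
    rw [add_zero, blockCyclic_diagonal_pow_length_mulVec_apply, Equiv.symm_apply_apply]
  have hcoef (r : ℕ) (q : Fin ℓ) (a : Fin m) :
      ∏ s ∈ Finset.range r, c (q + s • (1 : Fin ℓ)) a ≠ 0 :=
    Finset.prod_ne_zero_iff.mpr fun _ _ => hc _ _
  have hadd (p q : Fin ℓ) : q + ((p - q : Fin ℓ) : ℕ) • (1 : Fin ℓ) = p := by
    rw [Fin.nsmul_val_one, add_sub_cancel]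
  have hshift {u} (hu : u ∈ U) (p q : Fin ℓ) (b : Fin m) (h : u (finProdFinEquiv (q, b)) ≠ 0) :
      ∃ v ∈ U, v (finProdFinEquiv (p, b)) ≠ 0 := by
    refine ⟨_, hpow ((p - q : Fin ℓ) : ℕ) u hu, ?_⟩
    have h' := blockCyclic_diagonal_pow_mulVec_apply c ((p - q : Fin ℓ) : ℕ) u q b
    rw [hadd] at h'
    rw [h']
    exact mul_ne_zero (hcoef _ _ _) h
  have hsingle {u} (hu : u ∈ U) (a b : Fin m) (hab : a ≠ b)
      (h : u (finProdFinEquiv (0, b)) ≠ 0) : Pi.single (finProdFinEquiv (1, a)) 1 ∈ U := by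
    -- Since `a ≠ b`, the blocks `B q` with `q ≠ 0` send nothing from position `b` to position `a`.
    -- What survives is `B 0 a b * u (0, b)` in block `1`.
    have hmem := hcol (hUB _ (hcol hu b)) a
    rw [← U.smul_mem_iff (mul_ne_zero (hB0 a b hab) h)]
    convert hmem using 1
    refine funext (finProdFinEquiv_add_ind 1 fun q a' => ?_)
    rw [blockCyclic_mulVec_apply]
    by_cases ha : a' = a
    · subst ha
      simp only [Matrix.mulVec, dotProduct, Equiv.symm_apply_apply, mul_ite, mul_zero,
        Finset.sum_ite_eq', Finset.mem_univ, if_true]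
      by_cases hq : q = 0
      · subst hq
        simp
      · simp [hB q hq a' b hab, hq]
    · simp [ha]
  have hsingles (p q : Fin ℓ) (a : Fin m) (h : Pi.single (finProdFinEquiv (q, a)) 1 ∈ U) :
      Pi.single (finProdFinEquiv (p, a)) 1 ∈ U := by
    rw [← U.smul_mem_iff (hcoef ((p - q : Fin ℓ) : ℕ) q a)]
    convert hpow ((p - q : Fin ℓ) : ℕ) _ h using 1
    refine funext (finProdFinEquiv_add_ind (((p - q : Fin ℓ) : ℕ) • (1 : Fin ℓ)) fun q' a' => ?_)
    rw [blockCyclic_diagonal_pow_mulVec_apply]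
    by_cases hx : q' = q ∧ a' = a
    · obtain ⟨rfl, rfl⟩ := hx
      simp [hadd]
    · have hne : ¬ (q' + ((p - q : Fin ℓ) : ℕ) • (1 : Fin ℓ) = p ∧ a' = a) := by
        rintro ⟨h1, h2⟩
        exact hx ⟨add_right_cancel (h1.trans (hadd p q).symm), h2⟩
      simp only [Pi.smul_apply, Pi.single_apply, EmbeddingLike.apply_eq_iff_eq, Prod.mk.injEq,
        if_neg hx, if_neg hne, smul_zero, mul_zero]
  refine or_iff_not_imp_left.mpr fun hbot => ?_
  obtain ⟨u, hu, hu0⟩ := U.ne_bot_iff.mp hbot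
  obtain ⟨i, hi⟩ := Function.ne_iff.mp hu0
  obtain ⟨⟨q, b⟩, rfl⟩ := finProdFinEquiv.surjective i
  obtain ⟨v, hv, hvb⟩ := hshift hu 0 q b hi
  have hother (a : Fin m) (hab : a ≠ b) (p : Fin ℓ) :
      Pi.single (finProdFinEquiv (p, a)) 1 ∈ U :=
    hsingles p 1 a (hsingle hv a b hab hvb)
  have hall (p : Fin ℓ) (a : Fin m) : Pi.single (finProdFinEquiv (p, a)) 1 ∈ U := by
    by_cases hab : a = b
    · subst hab
      -- Position `b` itself is reached from another position `d`, whose basis vectors are already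
      -- in `U`; this needs `2 ≤ m`.
      have : Nontrivial (Fin m) := Fin.nontrivial_iff_two_le.mpr hm
      obtain ⟨d, hd⟩ := exists_ne a
      exact hsingles p 1 a (hsingle (hother d hd 0) a d hd.symm (by simp))
    · exact hother a hab p
  rw [eq_top_iff]
  intro w _
  rw [pi_eq_sum_univ' w]
  refine U.sum_mem fun i _ => U.smul_mem _ ?_
  obtain ⟨⟨p, a⟩, rfl⟩ := finProdFinEquiv.surjective i
  convert hall p a using 1

theorem isIrreducible_of_eq_bot_or_eq_top {k G V : Type*} [Field k] [Group G] [AddCommGroup V]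
    [Module k V] [Nontrivial V] (ρ : Representation k G V)
    (h : ∀ U : Submodule k V, (∀ g, ∀ v ∈ U, ρ g v ∈ U) → U = ⊥ ∨ U = ⊤) : ρ.IsIrreducible := by
  have hbot : (⊥ : Subrepresentation ρ).toSubmodule = ⊥ := rfl
  have htop : (⊤ : Subrepresentation ρ).toSubmodule = ⊤ := rfl
  have hnt : Nontrivial (Subrepresentation ρ) := ⟨⊥, ⊤, fun e => bot_ne_top (α := Submodule k V) (by
    rw [← hbot, e, htop])⟩
  exact ⟨fun W => (h W.toSubmodule fun g v hv => W.apply_mem_toSubmodule g hv).imp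
    (fun e => Subrepresentation.toSubmodule_injective (e.trans hbot.symm))
    (fun e => Subrepresentation.toSubmodule_injective (e.trans htop.symm))⟩

/-! ### Choice of the generators -/

/-- There is an invertible matrix all of whose off-diagonal entries are
nonzero. -/
theorem exists_generalLinearGroup_offDiag_ne_zero (k : Type*) [Field k] [Infinite k] (m : ℕ) :
    ∃ B : Matrix.GeneralLinearGroup (Fin m) k, ∀ a b, a ≠ b →
      (B : Matrix (Fin m) (Fin m) k) a b ≠ 0 := by
  classical
  -- The matrix is `1 + x • J` with `J` all ones. As `J * J = m • J`, it is invertible once `1 + m *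
  -- x ≠ 0`. If `m` vanishes in `k`, this holds for every `x`.
  obtain ⟨x, hx⟩ := Infinite.exists_notMem_finset ({0, -(m : k)⁻¹} : Finset k)
  simp only [Finset.mem_insert, Finset.mem_singleton, not_or] at hx
  obtain ⟨hx0, hx1⟩ := hx
  have hdet : 1 + m * x ≠ 0 := by
    intro h
    have hm : (m : k) ≠ 0 := by
      rintro h0
      simp [h0] at h
    exact hx1 (by field_simp; linear_combination h)
  have hJ : (Matrix.of fun _ _ : Fin m => (1 : k)) * (Matrix.of fun _ _ : Fin m => (1 : k)) =
      (m : k) • Matrix.of fun _ _ : Fin m => (1 : k) := by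
    ext
    simp [Matrix.mul_apply]
  set J : Matrix (Fin m) (Fin m) k := Matrix.of fun _ _ => 1 with hJdef
  obtain ⟨y, hy⟩ : ∃ y, x + y + x * y * m = 0 :=
    ⟨-x / (1 + m * x), by linear_combination div_mul_cancel₀ (-x) hdet⟩
  have hmul : (1 + x • J) * (1 + y • J) = 1 := by
    have : (1 + x • J) * (1 + y • J) = 1 + (x + y + x * y * m) • J := by
      rw [mul_add, add_mul, add_mul, smul_mul_smul_comm, hJ, smul_smul]
      simp only [mul_one, one_mul]
      module
    rw [this, hy, zero_smul, add_zero]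
  refine ⟨⟨_, _, hmul, mul_eq_one_comm.mp hmul⟩, fun a b hab => ?_⟩
  simpa [hJdef, Matrix.one_apply, hab] using hx0

theorem mainTheorem8 {k : Type*} [Field k] [IsAlgClosed k] (ℓ m : ℕ) (hℓ : 2 ≤ ℓ) (hm : 2 ≤ m)
    (hchar : ¬ ringChar k ∣ ℓ) :
    ∃ ρ : FreeGroup (Fin 2) →* Matrix.GeneralLinearGroup (Fin (ℓ * m)) k,
      (matrixRep ρ).IsIrreducible ∧
      ¬ IsThick (matrixRep ρ) m ∧
      ¬ IsThick (matrixRep ρ) ℓ ∧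
      (∃ α : Fin m → k, (∀ i, α i ≠ 0) ∧ Function.Injective α ∧
        (ρ (FreeGroup.of 0) : Matrix (Fin (ℓ * m)) (Fin (ℓ * m)) k) =
          blockCyclic fun j : Fin ℓ => if (j : ℕ) + 1 = ℓ then Matrix.diagonal α else 1) ∧
      (∃ B : Fin ℓ → Matrix.GeneralLinearGroup (Fin m) k,
        (ρ (FreeGroup.of 1) : Matrix (Fin (ℓ * m)) (Fin (ℓ * m)) k) =
          blockCyclic fun j : Fin ℓ => (B j : Matrix (Fin m) (Fin m) k)) := by
  have : NeZero ℓ := ⟨by omega⟩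
  have : NeZero m := ⟨by omega⟩
  have : NeZero (ℓ * m) := ⟨mul_ne_zero (NeZero.ne ℓ) (NeZero.ne m)⟩
  have : Infinite k := IsAlgClosed.instInfinite
  -- Equivalent to `(ℓ - 1) * (m - 1) ≥ 1`.
  have hadd : ℓ + m ≤ ℓ * m := by nlinarith
  obtain ⟨B₀, hB₀⟩ := exists_generalLinearGroup_offDiag_ne_zero k m
  let e : Fin m ↪ {x : k // x ≠ 0} :=
    Fin.valEmbedding.trans (Set.Finite.infinite_compl (Set.finite_singleton (0 : k))).natEmbedding
  let α : Fin m → k := fun i => e i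
  have hα0 (i) : α i ≠ 0 := (e i).2
  have hα : Function.Injective α := Subtype.val_injective.comp e.injective
  let c : Fin ℓ → Fin m → k := fun j a => if (j : ℕ) + 1 = ℓ then α a else 1
  have hc (q a) : c q a ≠ 0 := by
    dsimp only [c]
    split_ifs
    exacts [hα0 a, one_ne_zero]
  have hprod (a) : ∏ q, c q a = α a := by
    have hval : ((⟨ℓ - 1, by omega⟩ : Fin ℓ) : ℕ) + 1 = ℓ := by simp; omega
    rw [Finset.prod_eq_single (⟨ℓ - 1, by omega⟩ : Fin ℓ)]
    · exact if_pos hval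
    · intro q _ hq
      exact if_neg fun h => hq (Fin.ext (by simp; omega))
    · simp
  have hdiag (j : Fin ℓ) : (if (j : ℕ) + 1 = ℓ then Matrix.diagonal α else 1) =
      Matrix.diagonal (c j) := by
    dsimp only [c]
    split_ifs
    exacts [rfl, Matrix.diagonal_one.symm]
  have hcunit (j) : IsUnit (Matrix.diagonal (c j)) :=
    Matrix.isUnit_diagonal.mpr (Pi.isUnit_iff.mpr fun a => (hc j a).isUnit)
  let B : Fin ℓ → Matrix.GeneralLinearGroup (Fin m) k := fun j => if j = 0 then B₀ else 1
  have hBunit (j) : IsUnit (B j : Matrix (Fin m) (Fin m) k) := (B j).isUnit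
  obtain ⟨gA, hgA⟩ := isUnit_blockCyclic _ hcunit
  obtain ⟨gB, hgB⟩ := isUnit_blockCyclic _ hBunit
  let ρ : FreeGroup (Fin 2) →* Matrix.GeneralLinearGroup (Fin (ℓ * m)) k :=
    FreeGroup.lift ![gA, gB]
  have hρ0 : (ρ (FreeGroup.of 0) : Matrix (Fin (ℓ * m)) (Fin (ℓ * m)) k) =
      blockCyclic fun j => Matrix.diagonal (c j) := by simpa [ρ] using hgA
  have hρ1 : (ρ (FreeGroup.of 1) : Matrix (Fin (ℓ * m)) (Fin (ℓ * m)) k) =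
      blockCyclic fun j => (B j : Matrix (Fin m) (Fin m) k) := by simpa [ρ] using hgB
  have hblocks := exists_map_blockSubmodule (matrixRep ρ) fun i q => by
    fin_cases i
    · exact map_blockSubmodule_of_eq_blockCyclic ρ _ _ hcunit hρ0 q
    · exact map_blockSubmodule_of_eq_blockCyclic ρ _ _ hBunit hρ1 q
  refine ⟨ρ, isIrreducible_of_eq_bot_or_eq_top _ fun U hU => ?_,
    not_isThick_block _ hblocks hadd, not_isThick_transversal _ hblocks (by omega),
    ⟨α, hα0, hα, by simp only [hdiag, hρ0]⟩, B, hρ1⟩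
  refine eq_bot_or_eq_top_of_stable_blockCyclic hm c hc (by simpa only [hprod] using hα)
    (fun j => (B j : Matrix (Fin m) (Fin m) k)) (fun a b hab => by simpa [B] using hB₀ a b hab)
    (fun q hq a b hab => by simp [B, hq, hab]) U (fun u hu => ?_) (fun u hu => ?_)
  · simpa only [matrixRep_apply, hρ0] using hU (FreeGroup.of 0) u hu
  · simpa only [matrixRep_apply, hρ1] using hU (FreeGroup.of 1) u hu
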